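/- All manifolds are smooth, finite-dimensional, Hausdorff and second countable, and all maps between them are smooth. A \emph{fibration} is a surjective submersion; two fibrations $P$, $F$ on $M$ are \emph{transverse} if $TM=\operatorname{Ker}P_*\oplus\operatorname{Ker}F_*$. A (possibly singular) distribution is \emph{integrable} if through every point there passes an integral manifold, i.e. an injectively immersed manifold whose tangent space at each of its points is the value of the distribution there. Let $(M,\Xi)$ be a Poisson manifold, $\Xi^\sharp:T^*M\to TM$ the map with $\langle\alpha,\Xi^\sharp\beta\rangle=\Xi(\alpha,\beta)$, $H:M\to\mathbb R$ a function and $X_H=\Xi^\sharp\circ dH$. For a subspace $V\subset T_mM$ let $V^0\subset T_m^*M$ be its annihilator; $V$ is \emph{isotropic} if $V\subset\operatorname{Im}\Xi^\sharp$ and $V\cap\operatorname{Im}\Xi^\sharp\subset\Xi^\sharp(V^0)$. For a fibration $\Pi:M\to N$ and a vector field $X$ on $M$, a section $\sigma:N\to M$ of $\Pi$ solves the $\Pi$-HJE (Hamilton--Jacobi equation) for $(M,X)$ if $\sigma_*\circ\Pi_*\circ X\circ\sigma=X\circ\sigma$. A \emph{complete solution} of the $\Pi$-HJE for $(M,X)$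 is a surjective local diffeomorphism $\Sigma:N\times\Lambda\to M$, where $\Lambda$ is a manifold of dimension $\dim M-\dim N$, such that every $\sigma_\lambda=\Sigma(\cdot,\lambda)$ is a section of $\Pi$ that solves the $\Pi$-HJE. It is \emph{isotropic} if $\operatorname{Im}(\sigma_\lambda)_{*,n}$ is an isotropic subspace for all $n\in N$, $\lambda\in\Lambda$. Write $\Sigma^*\Xi$ for the Poisson structure on $N\times\Lambda$ with $(\Sigma^*\Xi)^\sharp=\Sigma_*^{-1}\circ\Xi^\sharp\circ(\Sigma^*)^{-1}$. The system $(M,X_H)$ is \emph{noncommutative integrable (NCI) by means of} a fibration $F:M\to\Lambda$ if every fiber of $\operatorname{Ker}F_*$ is isotropic, $X_H\in\operatorname{Ker}F_*$ and $\Xi^\sharp[(\operatorname{Ker}F_*)^0]$ is integrable; it is \emph{NCI} if it is so by means of some $F$. On open subsets $U\subset M$ these notions refer to $\Xi|_U$ and $X_H|_U$. \textbf{Theorem.} Let $(M,\Xi)$ be a Poisson manifold, $H:M\to\mathbb R$ a function and $\Pi:M\to N$ a fibration. 1. If there is an isotropic complete solution $\Sigma:N\times\Lambda\to M$ of the $\Pi$-HJE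 for $(M,X_H)$ such that $(\Sigma^*\Xi)^\sharp((TN\times0)^0)$ is integrable, then every $m\in M$ has an open neighborhood $U$ such that $(U,X_H|_U)$ is NCI. 2. If $(M,X_H)$ is NCI by means of $F$, with $F$ and $\Pi$ transverse, then every $m\in M$ has an open neighborhood $U$ for which there is an isotropic complete solution $\Sigma:\Pi(U)\times\Lambda'\to U$ (for some manifold $\Lambda'$) of the $\Pi|_U$-HJE for $(U,X_H|_U)$, where $\Pi|_U:U\to\Pi(U)$, such that $(\Sigma^*\Xi|_U)^\sharp((T\Pi(U)\times0)^0)$ is integrable. 3. If $(M,X_H)$ is NCI, then every $m\in M$ has an open neighborhood $U$ and a fibration $\pi:U\to N'$ onto some manifold $N'$ for which there is an isotropic complete solution $\Sigma:N'\times\Lambda'\to U$ (for some manifold $\Lambda'$) of the $\pi$-HJE for $(U,X_H|_U)$ such that $(\Sigma^*\Xi|_U)^\sharp((TN'\times0)^0)$ is integrable. -/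

import Mathlib

open scoped Manifold ContDiff
open TopologicalSpace

universe u v w

noncomputable section

namespace HamiltonJacobi

/-! ### Linear algebra of a `(0,2)`-tensor on the dual of a vector space -/

section Linear

variable {V : Type*} [AddCommGroup V] [Module ℝ V] [FiniteDimensional ℝ V]

/-- The map `Ξ♯ : V* → V` with `⟨α, Ξ♯ β⟩ = Ξ(α, β)`. -/
def sharp (B : LinearMap.BilinForm ℝ (Module.Dual ℝ V)) : Module.Dual ℝ V →ₗ[ℝ] V :=
  (Module.evalEquiv ℝ V).symm.toLinearMap ∘ₗ LinearMap.flip B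

theorem apply_sharp (B : LinearMap.BilinForm ℝ (Module.Dual ℝ V)) (α β : Module.Dual ℝ V) :
    α (sharp B β) = B α β := by
  simp [sharp]

/-- The map `Ξ♯ᵒᵖ : V* → V` with `⟨α, Ξ♯ᵒᵖ β⟩ = -Ξ(β, α)`. -/
def sharpOp (B : LinearMap.BilinForm ℝ (Module.Dual ℝ V)) : Module.Dual ℝ V →ₗ[ℝ] V :=
  sharp (-LinearMap.flip B)

theorem apply_sharpOp (B : LinearMap.BilinForm ℝ (Module.Dual ℝ V)) (α β : Module.Dual ℝ V) :
    α (sharpOp B β) = -B β α := by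
  simp [sharpOp, apply_sharp]

/-- `Ξ♯(W⁰)`, with `W⁰` the annihilator of `W`. -/
def perp (B : LinearMap.BilinForm ℝ (Module.Dual ℝ V)) (W : Submodule ℝ V) : Submodule ℝ V :=
  W.dualAnnihilator.map (sharp B)

/-- `W` is weakly isotropic: `W ∩ Im Ξ♯ ⊆ Ξ♯(W⁰)`. -/
def IsWeaklyIsotropic (B : LinearMap.BilinForm ℝ (Module.Dual ℝ V)) (W : Submodule ℝ V) : Prop :=
  W ⊓ LinearMap.range (sharp B) ≤ perp B W

/-- `W` is isotropic: it is weakly isotropic and contained in `Im Ξ♯ᵒᵖ`. -/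
def IsIsotropic (B : LinearMap.BilinForm ℝ (Module.Dual ℝ V)) (W : Submodule ℝ V) : Prop :=
  IsWeaklyIsotropic B W ∧ W ≤ LinearMap.range (sharpOp B)

end Linear

/-! ### Tensors, vector fields, fibrations and distributions on manifolds -/

section Manifolds

variable {E : Type*} [NormedAddCommGroup E] [NormedSpace ℝ E] [FiniteDimensional ℝ E]
  {H : Type*} [TopologicalSpace H] (I : ModelWithCorners ℝ E H)
  {M : Type*} [TopologicalSpace M] [ChartedSpace H M]
  {E' : Type*} [NormedAddCommGroup E'] [NormedSpace ℝ E'] [FiniteDimensional ℝ E']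
  {H' : Type*} [TopologicalSpace H'] (J : ModelWithCorners ℝ E' H')
  {N : Type*} [TopologicalSpace N] [ChartedSpace H' N]
  {E'' : Type*} [NormedAddCommGroup E''] [NormedSpace ℝ E''] [FiniteDimensional ℝ E'']
  {H'' : Type*} [TopologicalSpace H''] (K : ModelWithCorners ℝ E'' H'')
  {Λ : Type*} [TopologicalSpace Λ] [ChartedSpace H'' Λ]

instance (x : M) : FiniteDimensional ℝ (TangentSpace I x) :=
  inferInstanceAs (FiniteDimensional ℝ E)

/-- The differential of a real function, as a covector at `x`. -/
def diff (f : M → ℝ) (x : M) : Module.Dual ℝ (TangentSpace I x) :=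
  (show TangentSpace I x →L[ℝ] ℝ from mfderiv I 𝓘(ℝ, ℝ) f x).toLinearMap

variable (M) in
/-- A field of bilinear forms on the cotangent spaces of `M` (no regularity yet). -/
abbrev TensorField : Type _ :=
  ∀ x : M, LinearMap.BilinForm ℝ (Module.Dual ℝ (TangentSpace I x))

variable (M) in
/-- A field of tangent vectors on `M`. -/
abbrev VField : Type _ := ∀ x : M, TangentSpace I x

variable (M) in
/-- A (possibly singular) distribution on `M`. -/
abbrev Distribution : Type _ := ∀ x : M, Submodule ℝ (TangentSpace I x)

variable {I} in
/-- The bracket `{f, g} = Ξ(df, dg)`. -/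
def bracket (Ξ : TensorField I M) (f g : M → ℝ) (x : M) : ℝ :=
  Ξ x (diff I f x) (diff I g x)

variable {I} in
/-- `Ξ` is a Poisson structure: a smooth antisymmetric tensor satisfying the Jacobi identity.
Smoothness of the tensor is smoothness of `Ξ(df, dg)` for all smooth `f`, `g` (the
differentials of global smooth functions span every cotangent space and contain, near any given
point, local coordinate coframes). -/
structure IsPoisson (Ξ : TensorField I M) : Prop where
  smooth : ∀ f g : M → ℝ, ContMDiff I 𝓘(ℝ, ℝ) ∞ f → ContMDiff I 𝓘(ℝ, ℝ) ∞ g →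
    ContMDiff I 𝓘(ℝ, ℝ) ∞ (bracket Ξ f g)
  antisymm : ∀ (x : M) (α β : Module.Dual ℝ (TangentSpace I x)), Ξ x α β = -Ξ x β α
  jacobi : ∀ f g h : M → ℝ, ContMDiff I 𝓘(ℝ, ℝ) ∞ f → ContMDiff I 𝓘(ℝ, ℝ) ∞ g →
    ContMDiff I 𝓘(ℝ, ℝ) ∞ h → ∀ x : M,
      bracket Ξ (bracket Ξ f g) h x + bracket Ξ (bracket Ξ h f) g x
        + bracket Ξ (bracket Ξ g h) f x = 0

variable {I} in
/-- The Hamiltonian vector field `X_h = Ξ♯ ∘ dh`. -/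
def hamiltonianField (Ξ : TensorField I M) (h : M → ℝ) : VField I M :=
  fun x => sharp (Ξ x) (diff I h x)

variable {I} in
/-- The pull-back `Φ*Ξ` by a local diffeomorphism `Φ : N → M`:
`(Φ*Ξ)(α, β) = Ξ(α ∘ Φ_*⁻¹, β ∘ Φ_*⁻¹)`, so that `(Φ*Ξ)♯ = Φ_*⁻¹ ∘ Ξ♯ ∘ (Φ^*)⁻¹`. -/
def pullback (Φ : N → M) (Ξ : TensorField I M) : TensorField J N := fun p =>
  (Ξ (Φ p)).compl₁₂ ((mfderiv J I Φ p).inverse.toLinearMap.dualMap)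
    ((mfderiv J I Φ p).inverse.toLinearMap.dualMap)

variable {I} in
/-- Restriction of a tensor to an open subset. -/
def TensorField.restrict (Ξ : TensorField I M) (U : Opens M) : TensorField I U :=
  pullback I (Subtype.val : U → M) Ξ

variable {I} in
/-- Restriction of a vector field to an open subset. -/
def VField.restrict (X : VField I M) (U : Opens M) : VField I U :=
  VectorField.mpullback I I (Subtype.val : U → M) X

/-- Restriction of a map to open subsets of its domain and codomain. -/
def restrictOpens (f : M → N) (U : Opens M) (V : Opens N) (h : ∀ x ∈ U, f x ∈ V) : U → V :=
  fun x => ⟨f x, h x x.2⟩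

/-- A fibration is a smooth surjective submersion. -/
structure IsFibration (P : M → N) : Prop where
  smooth : ContMDiff I J ∞ P
  surjective : Function.Surjective P
  submersion : ∀ x : M, Function.Surjective (mfderiv I J P x)

/-- The vertical distribution `Ker P_*`. -/
def kerDist (P : M → N) : Distribution I M := fun x => LinearMap.ker (mfderiv I J P x).toLinearMap

/-- Two submersions `P`, `F` are transverse: `TM = Ker P_* ⊕ Ker F_*`. -/
def Transverse (P : M → N) (F : M → Λ) : Prop :=
  ∀ x : M, IsCompl (kerDist I J P x) (kerDist I K F x)

variable {I} in
/-- A distribution is integrable if every point lies on an integral manifold: an injectively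
immersed manifold whose tangent space at each of its points is the value of the distribution. The
rank of the distribution is not required to be constant. -/
def IsIntegrable (D : Distribution I M) : Prop :=
  ∀ x : M, ∃ (r : ℕ) (S : Type) (_ : TopologicalSpace S)
    (_ : ChartedSpace (EuclideanSpace ℝ (Fin r)) S) (_ : IsManifold (𝓡 r) ∞ S)
    (_ : T2Space S) (_ : SecondCountableTopology S) (i : S → M),
    ContMDiff (𝓡 r) I ∞ i ∧ Function.Injective i ∧
      (∀ s, Function.Injective (mfderiv (𝓡 r) I i s)) ∧ x ∈ Set.range i ∧
      ∀ s, LinearMap.range (mfderiv (𝓡 r) I i s).toLinearMap = D (i s)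

/-! ### Hamilton-Jacobi equation and complete solutions -/

/-- `σ` is a (smooth) section of `P` that solves the `P`-Hamilton-Jacobi equation
`σ_* ∘ P_* ∘ X ∘ σ = X ∘ σ` for `(M, X)`; the equation is an equality in the tangent bundle. -/
structure IsHJESolution (P : M → N) (X : VField I M) (σ : N → M) : Prop where
  smooth : ContMDiff J I ∞ σ
  isSection : ∀ n : N, P (σ n) = n
  hje : ∀ n : N, tangentMap J I σ (tangentMap I J P ⟨σ n, X (σ n)⟩) = ⟨σ n, X (σ n)⟩

/-- `S : N × Λ → M` is a complete solution of the `P`-Hamilton-Jacobi equation for `(M, X)`. -/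
structure IsCompleteSolution (P : M → N) (X : VField I M) (S : N × Λ → M) : Prop where
  dim_eq : Module.finrank ℝ E' + Module.finrank ℝ E'' = Module.finrank ℝ E
  surjective : Function.Surjective S
  isLocalDiffeomorph : IsLocalDiffeomorph (J.prod K) I ∞ S
  partialSolution : ∀ l : Λ, IsHJESolution I J P X (fun n => S (n, l))

/-- `S : N × Λ → M` is isotropic: so is the image of the differential of each `S(·, l)`. -/
def IsIsotropicFamily (Ξ : TensorField I M) (S : N × Λ → M) : Prop :=
  ∀ (l : Λ) (n : N), IsIsotropic (Ξ (S (n, l)))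
    (LinearMap.range (mfderiv J I (fun n' => S (n', l)) n).toLinearMap)

variable (N Λ) in
/-- The distribution `TN × 0` on `N × Λ`. -/
def horizontal : Distribution (J.prod K) (N × Λ) := fun p =>
  (Submodule.prod (⊤ : Submodule ℝ (TangentSpace J p.1)) (⊥ : Submodule ℝ (TangentSpace K p.2)))

/-- `F` witnesses noncommutative integrability of `(M, X)`: an isotropic fibration with
`X ∈ Ker F_*` and `Ξ♯((Ker F_*)⁰)` integrable. -/
structure IsNCIBy (Ξ : TensorField I M) (X : VField I M) (F : M → Λ) : Prop where
  fibration : IsFibration I K F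
  isotropic : ∀ x : M, IsIsotropic (Ξ x) (kerDist I K F x)
  firstIntegral : ∀ x : M, X x ∈ kerDist I K F x
  integrable : IsIntegrable (fun x => perp (Ξ x) (kerDist I K F x))

/-- `(M, X)` is noncommutative integrable, by means of some `F : M → Λ`. -/
def IsNCI (Ξ : TensorField I M) (X : VField I M) : Prop :=
  ∃ (l : ℕ) (Λ : Type w) (_ : TopologicalSpace Λ)
    (_ : ChartedSpace (EuclideanSpace ℝ (Fin l)) Λ) (_ : IsManifold (𝓡 l) ∞ Λ)
    (_ : T2Space Λ) (_ : SecondCountableTopology Λ) (F : M → Λ),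
    IsNCIBy I (𝓡 l) Ξ X F

/-- There is an isotropic complete solution `S : N × Λ → M` of the `P`-Hamilton-Jacobi equation
for `(M, X)`, for some manifold `Λ`, with `(S*Ξ)♯((TN × 0)⁰)` integrable. -/
def HasIntegrableIsotropicCompleteSolution (P : M → N) (Ξ : TensorField I M) (X : VField I M) :
    Prop :=
  ∃ (l : ℕ) (Λ : Type w) (_ : TopologicalSpace Λ)
    (_ : ChartedSpace (EuclideanSpace ℝ (Fin l)) Λ) (_ : IsManifold (𝓡 l) ∞ Λ)
    (_ : T2Space Λ) (_ : SecondCountableTopology Λ) (S : N × Λ → M),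
    IsCompleteSolution I J (𝓡 l) P X S ∧ IsIsotropicFamily I J Ξ S ∧
      IsIntegrable (fun p => perp (pullback (J.prod (𝓡 l)) S Ξ p) (horizontal J N (𝓡 l) Λ p))

end Manifolds

end HamiltonJacobi

end

open HamiltonJacobi

noncomputable section

namespace HamiltonJacobi

/-! ### Local diffeomorphisms -/

section LocalDiffeo

variable {E : Type*} [NormedAddCommGroup E] [NormedSpace ℝ E]
  {H : Type*} [TopologicalSpace H] {I : ModelWithCorners ℝ E H}
  {M : Type*} [TopologicalSpace M] [ChartedSpace H M]
  {E' : Type*} [NormedAddCommGroup E'] [NormedSpace ℝ E']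
  {H' : Type*} [TopologicalSpace H'] {J : ModelWithCorners ℝ E' H'}
  {N : Type*} [TopologicalSpace N] [ChartedSpace H' N]
  {E₁ : Type*} [NormedAddCommGroup E₁] [NormedSpace ℝ E₁]
  {H₁ : Type*} [TopologicalSpace H₁] {I₁ : ModelWithCorners ℝ E₁ H₁}
  {M₁ : Type*} [TopologicalSpace M₁] [ChartedSpace H₁ M₁]
  {E₁' : Type*} [NormedAddCommGroup E₁'] [NormedSpace ℝ E₁']
  {H₁' : Type*} [TopologicalSpace H₁'] {J₁ : ModelWithCorners ℝ E₁' H₁'}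
  {N₁ : Type*} [TopologicalSpace N₁] [ChartedSpace H₁' N₁]

theorem infty_ne_zero : (∞ : WithTop ℕ∞) ≠ 0 := by simp

/-- Restriction of a partial diffeomorphism to an open subset of its source. -/
def restrPartialDiffeomorph (Φ : PartialDiffeomorph I J M N ∞) {s : Set M} (hs : IsOpen s) :
    PartialDiffeomorph I J M N ∞ where
  toPartialEquiv := (Φ.toOpenPartialHomeomorph.restrOpen s hs).toPartialEquiv
  open_source := (Φ.toOpenPartialHomeomorph.restrOpen s hs).open_source
  open_target := (Φ.toOpenPartialHomeomorph.restrOpen s hs).open_target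
  contMDiffOn_toFun := Φ.contMDiffOn_toFun.mono fun _ hx => hx.1
  contMDiffOn_invFun := Φ.contMDiffOn_invFun.mono fun _ hx => hx.1

theorem _root_.IsLocalDiffeomorphAt.congr_of_eventuallyEq {f g : M → N} {x : M}
    (hf : IsLocalDiffeomorphAt I J ∞ f x) (h : g =ᶠ[nhds x] f) :
    IsLocalDiffeomorphAt I J ∞ g x := by
  obtain ⟨Φ, hx, hΦ⟩ := hf
  obtain ⟨s, hs, hso, hxs⟩ := eventually_nhds_iff.1 h
  exact ⟨restrPartialDiffeomorph Φ hso, ⟨hx, hxs⟩, fun y hy => (hs y hy.2).trans (hΦ hy.1)⟩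

theorem _root_.IsLocalDiffeomorphAt.isInvertible_mfderiv {f : M → N} {x : M}
    (hf : IsLocalDiffeomorphAt I J ∞ f x) : (mfderiv I J f x).IsInvertible :=
  ⟨hf.mfderivToContinuousLinearEquiv infty_ne_zero, rfl⟩

theorem _root_.IsLocalDiffeomorphAt.prodMap {f : M → N} {g : M₁ → N₁} {p : M × M₁}
    (hf : IsLocalDiffeomorphAt I J ∞ f p.1) (hg : IsLocalDiffeomorphAt I₁ J₁ ∞ g p.2) :
    IsLocalDiffeomorphAt (I.prod I₁) (J.prod J₁) ∞ (Prod.map f g) p := by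
  obtain ⟨Φ, hx, hΦ⟩ := hf
  obtain ⟨Ψ, hy, hΨ⟩ := hg
  exact ⟨{ toPartialEquiv := Φ.toPartialEquiv.prod Ψ.toPartialEquiv
           open_source := Φ.open_source.prod Ψ.open_source
           open_target := Φ.open_target.prod Ψ.open_target
           contMDiffOn_toFun := Φ.contMDiffOn_toFun.prodMap Ψ.contMDiffOn_toFun
           contMDiffOn_invFun := Φ.contMDiffOn_invFun.prodMap Ψ.contMDiffOn_invFun },
    ⟨hx, hy⟩, fun q hq => Prod.ext (hΦ hq.1) (hΨ hq.2)⟩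

theorem isLocalDiffeomorph_subtype_val (U : Opens M) :
    IsLocalDiffeomorph I I ∞ (Subtype.val : U → M) := fun x => by
  let e := U.openPartialHomeomorphSubtypeCoe ⟨x⟩
  have htar : e.target = U := U.openPartialHomeomorphSubtypeCoe_target ⟨x⟩
  refine ⟨{ toPartialEquiv := e.toPartialEquiv
            open_source := e.open_source
            open_target := e.open_target
            contMDiffOn_toFun := contMDiff_subtype_val.contMDiffOn
            contMDiffOn_invFun := fun y hy => ContMDiffAt.contMDiffWithinAt ?_ },
    Set.mem_univ x, fun _ _ => rfl⟩
  refine (ContMDiffAt.subtypeVal_comp_iff U e.symm y).1 ?_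
  refine contMDiffAt_id.congr_of_eventuallyEq ?_
  filter_upwards [e.open_target.mem_nhds hy] with z hz
  exact e.right_inv hz

theorem isInvertible_mfderiv_subtype_val (U : Opens M) (x : U) :
    (mfderiv I I (Subtype.val : U → M) x).IsInvertible :=
  (isLocalDiffeomorph_subtype_val U x).isInvertible_mfderiv

theorem isLocalDiffeomorphAt_extChartAt [I.Boundaryless] [IsManifold I ∞ M] (x : M) :
    IsLocalDiffeomorphAt I 𝓘(ℝ, E) ∞ (extChartAt I x) x :=
  ⟨{ toPartialEquiv := extChartAt I x
     open_source := isOpen_extChartAt_source x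
     open_target := isOpen_extChartAt_target x
     contMDiffOn_toFun := by
      simpa only [extChartAt_source] using contMDiffOn_extChartAt (I := I) (n := ∞) (x := x)
     contMDiffOn_invFun := contMDiffOn_extChartAt_symm x },
    mem_extChartAt_source x, fun _ _ => rfl⟩

/-- The inverse function theorem in a Banach space. -/
theorem isLocalDiffeomorphAt_of_isInvertible_fderiv [CompleteSpace E] {f : E → E'} {s : Set E}
    (hs : IsOpen s) (hf : ContDiffOn ℝ ∞ f s) {x : E} (hx : x ∈ s)
    (hinv : (fderiv ℝ f x).IsInvertible) : IsLocalDiffeomorphAt 𝓘(ℝ, E) 𝓘(ℝ, E') ∞ f x := by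
  have hat : ∀ y ∈ s, ContDiffAt ℝ ∞ f y := fun y hy => hf.contDiffAt (hs.mem_nhds hy)
  obtain ⟨L, hL⟩ := hinv
  have hder : HasFDerivAt f (L : E →L[ℝ] E') x := by
    rw [hL]; exact ((hat x hx).differentiableAt infty_ne_zero).hasFDerivAt
  let e := (hat x hx).toOpenPartialHomeomorph f hder infty_ne_zero
  let t : Set E := s ∩ fderiv ℝ f ⁻¹' Set.range ContinuousLinearEquiv.toContinuousLinearMap
  have ht : IsOpen t := (hf.continuousOn_fderiv_of_isOpen hs (by simp)).isOpen_inter_preimage hs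
    ContinuousLinearEquiv.isOpen
  let e' := e.restrOpen t ht
  have hxe : x ∈ e.source := (hat x hx).mem_toOpenPartialHomeomorph_source hder infty_ne_zero
  refine ⟨{ toPartialEquiv := e'.toPartialEquiv
            open_source := e'.open_source
            open_target := e'.open_target
            contMDiffOn_toFun := contMDiffOn_iff_contDiffOn.2 (hf.mono fun y hy => hy.2.1)
            contMDiffOn_invFun := contMDiffOn_iff_contDiffOn.2 fun y hy =>
              ContDiffAt.contDiffWithinAt ?_ }, ⟨hxe, hx, ⟨L, hL⟩⟩, fun _ _ => rfl⟩
  have hy' : e'.symm y ∈ e'.source := e'.map_target hy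
  obtain ⟨K, hK⟩ := hy'.2.2
  refine e'.contDiffAt_symm hy (f₀' := K) ?_ (hat _ hy'.2.1)
  rw [hK]
  exact ((hat _ hy'.2.1).differentiableAt infty_ne_zero).hasFDerivAt

/-- The inverse function theorem on manifolds without boundary. -/
theorem isLocalDiffeomorphAt_of_isInvertible_mfderiv [CompleteSpace E] [I.Boundaryless]
    [J.Boundaryless] [IsManifold I ∞ M] [IsManifold J ∞ N] {f : M → N} {s : Set M}
    (hs : IsOpen s) (hf : ContMDiffOn I J ∞ f s) {x : M} (hx : x ∈ s)
    (hinv : (mfderiv I J f x).IsInvertible) : IsLocalDiffeomorphAt I J ∞ f x := by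
  obtain ⟨φ, hφx, hφ⟩ := isLocalDiffeomorphAt_extChartAt (I := I) x
  obtain ⟨ψ, hψx, hψ⟩ := isLocalDiffeomorphAt_extChartAt (I := J) (f x)
  have hso : IsOpen (s ∩ f ⁻¹' ψ.source) := hf.continuousOn.isOpen_inter_preimage hs ψ.open_source
  let t : Set E := φ.symm.source ∩ φ.symm ⁻¹' (s ∩ f ⁻¹' ψ.source)
  have ht : IsOpen t := φ.symm.contMDiffOn.continuousOn.isOpen_inter_preimage φ.open_target hso
  let g : E → E' := ψ ∘ f ∘ φ.symm
  have hleft : φ.symm (φ x) = x := φ.left_inv hφx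
  have hgs : ContMDiffOn 𝓘(ℝ, E) 𝓘(ℝ, E') ∞ g t :=
    ψ.contMDiffOn.comp (hf.comp (φ.symm.contMDiffOn.mono fun y hy => hy.1) fun y hy => hy.2.1)
      fun y hy => hy.2.2
  have hxt : φ x ∈ t := ⟨φ.map_source hφx, by
    show φ.symm (φ x) ∈ s ∩ f ⁻¹' ψ.source
    rw [hleft]; exact ⟨hx, hψx⟩⟩
  have hfx : MDifferentiableAt I J f x :=
    (hf.contMDiffAt (hs.mem_nhds hx)).mdifferentiableAt infty_ne_zero
  have hφs : IsLocalDiffeomorphAt 𝓘(ℝ, E) I ∞ φ.symm (φ x) :=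
    φ.symm.isLocalDiffeomorphAt _ _ _ (φ.map_source hφx)
  have hψs : IsLocalDiffeomorphAt J 𝓘(ℝ, E') ∞ ψ (f x) := ψ.isLocalDiffeomorphAt _ _ _ hψx
  have hginv : (mfderiv 𝓘(ℝ, E) 𝓘(ℝ, E') g (φ x)).IsInvertible := by
    have h1 : mfderiv 𝓘(ℝ, E) J (f ∘ φ.symm) (φ x) =
        (mfderiv I J f (φ.symm (φ x))).comp (mfderiv 𝓘(ℝ, E) I φ.symm (φ x)) :=
      mfderiv_comp _ (by rw [hleft]; exact hfx) (hφs.mdifferentiableAt infty_ne_zero)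
    have h2 : mfderiv 𝓘(ℝ, E) 𝓘(ℝ, E') g (φ x) =
        (mfderiv J 𝓘(ℝ, E') ψ (f (φ.symm (φ x)))).comp
          (mfderiv 𝓘(ℝ, E) J (f ∘ φ.symm) (φ x)) :=
      mfderiv_comp (φ x) (by
          simp only [Function.comp_apply]
          rw [hleft]; exact hψs.mdifferentiableAt infty_ne_zero)
        (MDifferentiableAt.comp (φ x) (by rw [hleft]; exact hfx)
          (hφs.mdifferentiableAt infty_ne_zero))
    rw [h2, h1]
    refine .comp ?_ (.comp ?_ hφs.isInvertible_mfderiv)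
    · rw [hleft]; exact hψs.isInvertible_mfderiv
    · rw [hleft]; exact hinv
  have hg : IsLocalDiffeomorphAt 𝓘(ℝ, E) 𝓘(ℝ, E') ∞ g (φ x) :=
    isLocalDiffeomorphAt_of_isInvertible_fderiv ht (contMDiffOn_iff_contDiffOn.1 hgs) hxt
      (by rwa [mfderiv_eq_fderiv] at hginv)
  have hψi : IsLocalDiffeomorphAt 𝓘(ℝ, E') J ∞ ψ.symm (g (φ x)) :=
    ψ.symm.isLocalDiffeomorphAt _ _ _ (ψ.map_source (by
      simp only [Function.comp_apply]; rw [hleft]; exact hψx))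
  have hcomp : IsLocalDiffeomorphAt I J ∞ (ψ.symm ∘ g ∘ φ) x :=
    ((φ.isLocalDiffeomorphAt _ _ _ hφx).comp 𝓘(ℝ, E') E' (g := g) hg).comp J N (g := ψ.symm) hψi
  refine hcomp.congr_of_eventuallyEq ?_
  filter_upwards [hso.mem_nhds ⟨hx, hψx⟩, φ.open_source.mem_nhds hφx] with y hy hyφ
  have hly : φ.symm (φ y) = y := φ.left_inv hyφ
  simp only [g, Function.comp_apply]
  rw [hly]
  exact (ψ.left_inv hy.2).symm

end LocalDiffeo

/-! ### Naturality of the linear notions -/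

section Linear

variable {V : Type*} [AddCommGroup V] [Module ℝ V]
  {V' : Type*} [AddCommGroup V'] [Module ℝ V']

/-- The pull-back of a `(0,2)`-tensor on the dual along a linear equivalence. -/
abbrev pullForm (T : V ≃ₗ[ℝ] V') (B : LinearMap.BilinForm ℝ (Module.Dual ℝ V')) :
    LinearMap.BilinForm ℝ (Module.Dual ℝ V) :=
  B.compl₁₂ T.symm.toLinearMap.dualMap T.symm.toLinearMap.dualMap

theorem dualMap_symm_mem_dualAnnihilator (T : V ≃ₗ[ℝ] V') (W : Submodule ℝ V)
    (β : Module.Dual ℝ V) :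
    T.symm.toLinearMap.dualMap β ∈ (W.map T.toLinearMap).dualAnnihilator ↔
      β ∈ W.dualAnnihilator := by
  simp only [Submodule.mem_dualAnnihilator, Submodule.mem_map, forall_exists_index, and_imp,
    forall_apply_eq_imp_iff₂, LinearMap.dualMap_apply, LinearEquiv.coe_coe,
    LinearEquiv.symm_apply_apply]

theorem exists_dualMap_symm_eq (T : V ≃ₗ[ℝ] V') (γ : Module.Dual ℝ V') :
    ∃ β : Module.Dual ℝ V, T.symm.toLinearMap.dualMap β = γ :=
  ⟨γ ∘ₗ T.toLinearMap, by ext v; simp⟩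

theorem neg_flip_pullForm (T : V ≃ₗ[ℝ] V') (B : LinearMap.BilinForm ℝ (Module.Dual ℝ V')) :
    -LinearMap.flip (pullForm T B) = pullForm T (-LinearMap.flip B) := by
  ext; simp

variable [FiniteDimensional ℝ V] [FiniteDimensional ℝ V']

theorem apply_sharp_pullForm (T : V ≃ₗ[ℝ] V') (B : LinearMap.BilinForm ℝ (Module.Dual ℝ V'))
    (β : Module.Dual ℝ V) :
    T (sharp (pullForm T B) β) = sharp B (T.symm.toLinearMap.dualMap β) := by
  rw [← sub_eq_zero, ← Module.forall_dual_apply_eq_zero_iff ℝ]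
  intro α
  rw [map_sub, sub_eq_zero]
  rw [apply_sharp]
  have := apply_sharp (pullForm T B) (α ∘ₗ T.toLinearMap) β
  simp only [LinearMap.comp_apply, LinearEquiv.coe_coe] at this
  rw [this, LinearMap.compl₁₂_apply]
  congr 1
  congr 1
  ext v; simp

theorem map_perp_pullForm (T : V ≃ₗ[ℝ] V') (B : LinearMap.BilinForm ℝ (Module.Dual ℝ V'))
    (W : Submodule ℝ V) :
    (perp (pullForm T B) W).map T.toLinearMap = perp B (W.map T.toLinearMap) := by
  ext v
  constructor
  · rintro ⟨_, ⟨β, hβ, rfl⟩, rfl⟩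
    exact ⟨_, (dualMap_symm_mem_dualAnnihilator T W β).2 hβ, (apply_sharp_pullForm T B β).symm⟩
  · rintro ⟨γ, hγ, rfl⟩
    obtain ⟨β, rfl⟩ := exists_dualMap_symm_eq T γ
    exact ⟨_, ⟨β, (dualMap_symm_mem_dualAnnihilator T W β).1 hγ, rfl⟩, apply_sharp_pullForm T B β⟩

theorem map_range_sharp_pullForm (T : V ≃ₗ[ℝ] V')
    (B : LinearMap.BilinForm ℝ (Module.Dual ℝ V')) :
    (LinearMap.range (sharp (pullForm T B))).map T.toLinearMap = LinearMap.range (sharp B) := by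
  have h := map_perp_pullForm T B ⊥
  simpa [perp, Submodule.dualAnnihilator_bot] using h

theorem isIsotropic_pullForm_iff (T : V ≃ₗ[ℝ] V')
    (B : LinearMap.BilinForm ℝ (Module.Dual ℝ V')) (W : Submodule ℝ V) :
    IsIsotropic (pullForm T B) W ↔ IsIsotropic B (W.map T.toLinearMap) := by
  have hT : Function.Injective T.toLinearMap := T.injective
  have h1 : IsWeaklyIsotropic (pullForm T B) W ↔ IsWeaklyIsotropic B (W.map T.toLinearMap) := by
    unfold IsWeaklyIsotropic
    rw [← map_perp_pullForm, ← map_range_sharp_pullForm T B, ← Submodule.map_inf _ hT,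
      Submodule.map_le_map_iff_of_injective hT]
  have h2 : W ≤ LinearMap.range (sharpOp (pullForm T B)) ↔
      W.map T.toLinearMap ≤ LinearMap.range (sharpOp B) := by
    unfold sharpOp
    rw [neg_flip_pullForm, ← map_range_sharp_pullForm T (-LinearMap.flip B),
      Submodule.map_le_map_iff_of_injective hT]
  exact and_congr h1 h2

end Linear

section Naturality

variable {E : Type*} [NormedAddCommGroup E] [NormedSpace ℝ E]
  {H : Type*} [TopologicalSpace H] {I : ModelWithCorners ℝ E H}
  {M : Type*} [TopologicalSpace M] [ChartedSpace H M]
  {E' : Type*} [NormedAddCommGroup E'] [NormedSpace ℝ E']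
  {H' : Type*} [TopologicalSpace H'] {J : ModelWithCorners ℝ E' H'}
  {N : Type*} [TopologicalSpace N] [ChartedSpace H' N]
  {E'' : Type*} [NormedAddCommGroup E''] [NormedSpace ℝ E'']
  {H'' : Type*} [TopologicalSpace H''] {K : ModelWithCorners ℝ E'' H''}
  {Λ : Type*} [TopologicalSpace Λ] [ChartedSpace H'' Λ]

/-! ### Naturality of tensors under local diffeomorphisms -/

theorem exists_pullback_eq_pullForm {f : N → M} {p : N}
    (hf : (mfderiv J I f p).IsInvertible) (Ξ : TensorField I M) :
    ∃ T : TangentSpace J p ≃ₗ[ℝ] TangentSpace I (f p),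
      T.toLinearMap = (mfderiv J I f p).toLinearMap ∧
        pullback J f Ξ p = pullForm T (Ξ (f p)) := by
  obtain ⟨T, hT⟩ := hf
  refine ⟨T.toLinearEquiv, by rw [← hT]; rfl, ?_⟩
  unfold pullback
  rw [← hT, ContinuousLinearMap.inverse_equiv]
  rfl

theorem pullback_comp {g : N → M} {f : Λ → N} (hg : IsLocalDiffeomorph J I ∞ g)
    (hf : IsLocalDiffeomorph K J ∞ f) (Ξ : TensorField I M) :
    pullback K (g ∘ f) Ξ = pullback K f (pullback J g Ξ) := by
  funext p
  have h := mfderiv_comp p ((hg (f p)).mdifferentiableAt infty_ne_zero)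
    ((hf p).mdifferentiableAt infty_ne_zero)
  unfold pullback
  rw [h, (hg (f p)).isInvertible_mfderiv.inverse_comp_of_left]
  rfl

theorem map_mfderiv_comp {g : N → M} {f : Λ → N} {p : Λ} (hg : MDifferentiableAt J I g (f p))
    (hf : MDifferentiableAt K J f p) (W : Submodule ℝ (TangentSpace K p)) :
    W.map (mfderiv K I (g ∘ f) p).toLinearMap =
      (W.map (mfderiv K J f p).toLinearMap).map (mfderiv J I g (f p)).toLinearMap := by
  rw [mfderiv_comp p hg hf]
  exact Submodule.map_comp _ _ _

theorem range_mfderiv_comp {g : N → M} {f : Λ → N} {p : Λ} (hg : MDifferentiableAt J I g (f p))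
    (hf : MDifferentiableAt K J f p) :
    LinearMap.range (mfderiv K I (g ∘ f) p).toLinearMap =
      (LinearMap.range (mfderiv K J f p).toLinearMap).map
        (mfderiv J I g (f p)).toLinearMap := by
  rw [LinearMap.range_eq_map, map_mfderiv_comp hg hf, ← LinearMap.range_eq_map]

/-! ### Integrability under local diffeomorphisms -/

/-- If a distribution is integrable, so is the one that corresponds to it under a local
diffeomorphism into its base. -/
theorem IsIntegrable.pull {f : N → M} (hf : IsLocalDiffeomorph J I ∞ f)
    {D : Distribution I M} {D' : Distribution J N}
    (h : ∀ p, (D' p).map (mfderiv J I f p).toLinearMap = D (f p)) (hD : IsIntegrable D) :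
    IsIntegrable D' := by
  intro p
  obtain ⟨r, S, _, _, _, _, _, i, hi, hinj, himm, ⟨s₀, hs₀⟩, hr⟩ := hD (f p)
  obtain ⟨Φ, hpΦ, hΦ⟩ := hf p
  let W : Opens S := ⟨i ⁻¹' Φ.target, Φ.open_target.preimage hi.continuous⟩
  let i' : W → N := fun s => Φ.symm (i s)
  have hfi : f ∘ i' = i ∘ Subtype.val := by
    funext s
    have hs : i' s ∈ Φ.source := Φ.map_target s.2
    exact (hΦ hs).trans (Φ.right_inv s.2)
  have hival : ContMDiff (𝓡 r) I ∞ (i ∘ (Subtype.val : W → S)) := hi.comp contMDiff_subtype_val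
  have hi' : ContMDiff (𝓡 r) J ∞ i' := by
    rw [← contMDiffOn_univ]
    exact Φ.symm.contMDiffOn.comp hival.contMDiffOn fun s _ => s.2
  have hd : ∀ s, MDifferentiableAt (𝓡 r) J i' s := fun s =>
    (hi' s).mdifferentiableAt infty_ne_zero
  have hdf : ∀ q, MDifferentiableAt J I f q := fun q => (hf q).mdifferentiableAt infty_ne_zero
  have hfi_inj : ∀ s, Function.Injective (mfderiv (𝓡 r) I (f ∘ i') s) := by
    rw [hfi]
    intro s
    rw [mfderiv_comp s ((hi _).mdifferentiableAt infty_ne_zero)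
      ((contMDiff_subtype_val s).mdifferentiableAt infty_ne_zero)]
    exact (himm _).comp (isInvertible_mfderiv_subtype_val W s).injective
  have hfi_range : ∀ s, LinearMap.range (mfderiv (𝓡 r) I (f ∘ i') s).toLinearMap =
      D ((f ∘ i') s) := by
    rw [hfi]
    intro s
    rw [range_mfderiv_comp ((hi _).mdifferentiableAt infty_ne_zero)
      ((contMDiff_subtype_val s).mdifferentiableAt infty_ne_zero),
      LinearMap.range_eq_top.2 (isInvertible_mfderiv_subtype_val W s).surjective,
      ← LinearMap.range_eq_map]
    exact hr s
  refine ⟨r, W, inferInstance, inferInstance, inferInstance, inferInstance, inferInstance, i', hi',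
    ?_, ?_, ?_, ?_⟩
  · intro s t hst
    have : (f ∘ i') s = (f ∘ i') t := congrArg f hst
    rw [hfi] at this
    exact Subtype.ext (hinj this)
  · intro s
    have := hfi_inj s
    rw [mfderiv_comp s (hdf _) (hd s)] at this
    exact Function.Injective.of_comp this
  · have hfp : f p = Φ p := hΦ hpΦ
    refine ⟨⟨s₀, ?_⟩, ?_⟩
    · show i s₀ ∈ Φ.target
      rw [hs₀, hfp]; exact Φ.map_source hpΦ
    · show Φ.symm (i s₀) = p
      rw [hs₀, hfp]; exact Φ.left_inv hpΦ
  · intro s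
    have hI : Function.Injective (mfderiv J I f (i' s)).toLinearMap :=
      (hf (i' s)).isInvertible_mfderiv.injective
    apply Submodule.map_injective_of_injective hI
    rw [h, ← range_mfderiv_comp (hdf _) (hd s)]
    exact hfi_range s

/-- If a distribution is integrable, so is the one that corresponds to it under a surjective local
diffeomorphism out of its base. -/
theorem IsIntegrable.push {f : N → M} (hf : IsLocalDiffeomorph J I ∞ f)
    (hsurj : Function.Surjective f) {D : Distribution I M} {D' : Distribution J N}
    (h : ∀ p, (D' p).map (mfderiv J I f p).toLinearMap = D (f p)) (hD' : IsIntegrable D') :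
    IsIntegrable D := by
  intro x
  obtain ⟨p, rfl⟩ := hsurj x
  obtain ⟨r, S, _, _, _, _, _, i, hi, hinj, himm, ⟨s₀, hs₀⟩, hr⟩ := hD' p
  obtain ⟨Φ, hpΦ, hΦ⟩ := hf p
  let W : Opens S := ⟨i ⁻¹' Φ.source, Φ.open_source.preimage hi.continuous⟩
  have hdi : ∀ s, MDifferentiableAt (𝓡 r) J i s := fun s =>
    (hi s).mdifferentiableAt infty_ne_zero
  have hdf : ∀ q, MDifferentiableAt J I f q := fun q => (hf q).mdifferentiableAt infty_ne_zero
  have hdv : ∀ s : W, MDifferentiableAt (𝓡 r) (𝓡 r) (Subtype.val : W → S) s := fun s =>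
    (contMDiff_subtype_val s).mdifferentiableAt infty_ne_zero
  have hdiv : ∀ s : W, MDifferentiableAt (𝓡 r) J (i ∘ (Subtype.val : W → S)) s := fun s =>
    (hdi s).comp s (hdv s)
  refine ⟨r, W, inferInstance, inferInstance, inferInstance, inferInstance, inferInstance,
    f ∘ i ∘ Subtype.val, hf.contMDiff.comp (hi.comp contMDiff_subtype_val), ?_, ?_, ?_, ?_⟩
  · intro s t hst
    have hs : i s ∈ Φ.source := s.2
    have ht : i t ∈ Φ.source := t.2
    have : Φ (i s) = Φ (i t) := by rw [← hΦ hs, ← hΦ ht]; exact hst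
    exact Subtype.ext (hinj (Φ.injOn hs ht this))
  · intro s
    rw [mfderiv_comp s (hdf _) (hdiv s), mfderiv_comp s (hdi _) (hdv s)]
    exact (hf _).isInvertible_mfderiv.injective.comp
      ((himm _).comp (isInvertible_mfderiv_subtype_val W s).injective)
  · refine ⟨⟨s₀, ?_⟩, congrArg f hs₀⟩
    show i s₀ ∈ Φ.source
    rw [hs₀]; exact hpΦ
  · intro s
    rw [range_mfderiv_comp (hdf _) (hdiv s), range_mfderiv_comp (hdi _) (hdv s),
      LinearMap.range_eq_top.2 (isInvertible_mfderiv_subtype_val W s).surjective,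
      ← LinearMap.range_eq_map, hr]
    exact h _

variable [FiniteDimensional ℝ E] [FiniteDimensional ℝ E']

theorem map_perp_pullback {f : N → M} {p : N} (hf : (mfderiv J I f p).IsInvertible)
    (Ξ : TensorField I M) (W : Submodule ℝ (TangentSpace J p)) :
    (perp (pullback J f Ξ p) W).map (mfderiv J I f p).toLinearMap =
      perp (Ξ (f p)) (W.map (mfderiv J I f p).toLinearMap) := by
  obtain ⟨T, hT, h⟩ := exists_pullback_eq_pullForm hf Ξ
  rw [h, ← hT]
  exact map_perp_pullForm T _ W

theorem isIsotropic_pullback_iff {f : N → M} {p : N} (hf : (mfderiv J I f p).IsInvertible)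
    (Ξ : TensorField I M) (W : Submodule ℝ (TangentSpace J p)) :
    IsIsotropic (pullback J f Ξ p) W ↔
      IsIsotropic (Ξ (f p)) (W.map (mfderiv J I f p).toLinearMap) := by
  obtain ⟨T, hT, h⟩ := exists_pullback_eq_pullForm hf Ξ
  rw [h, ← hT]
  exact isIsotropic_pullForm_iff T _ W

end Naturality

section Adapted

variable {E : Type*} [NormedAddCommGroup E] [NormedSpace ℝ E]
  {H : Type*} [TopologicalSpace H] {I : ModelWithCorners ℝ E H}
  {M : Type*} [TopologicalSpace M] [ChartedSpace H M]
  {E' : Type*} [NormedAddCommGroup E'] [NormedSpace ℝ E']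
  {H' : Type*} [TopologicalSpace H'] {J : ModelWithCorners ℝ E' H'}
  {N : Type*} [TopologicalSpace N] [ChartedSpace H' N]
  {N₁ : Type*} [TopologicalSpace N₁] [ChartedSpace H' N₁]
  {E'' : Type*} [NormedAddCommGroup E''] [NormedSpace ℝ E'']
  {H'' : Type*} [TopologicalSpace H''] {K : ModelWithCorners ℝ E'' H''}
  {Λ : Type*} [TopologicalSpace Λ] [ChartedSpace H'' Λ]
  {Λ₁ : Type*} [TopologicalSpace Λ₁] [ChartedSpace H'' Λ₁]

/-! ### Slices of local product structures -/

theorem range_mfderiv_slice {f : N × Λ → M} {n : N} {l : Λ}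
    (hf : MDifferentiableAt (J.prod K) I f (n, l)) :
    LinearMap.range (mfderiv J I (fun n' => f (n', l)) n).toLinearMap =
      (horizontal J N K Λ (n, l)).map (mfderiv (J.prod K) I f (n, l)).toLinearMap := by
  have hs : MDifferentiableAt J (J.prod K) (fun n' : N => (n', l)) n :=
    mdifferentiableAt_id.prodMk mdifferentiableAt_const
  have h := range_mfderiv_comp (f := fun n' : N => (n', l)) hf hs
  refine h.trans (congrArg _ ?_)
  rw [mfderiv_prod_left]
  ext v
  constructor
  · rintro ⟨w, rfl⟩
    exact ⟨trivial, rfl⟩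
  · rintro ⟨-, hv⟩
    exact ⟨v.1, Prod.ext rfl (Eq.symm hv)⟩

theorem kerDist_eq_map_horizontal {f : N × Λ → M} {q : M → Λ₁} {g : Λ → Λ₁}
    (hqf : q ∘ f = g ∘ Prod.snd) {p : N × Λ} (hf : IsLocalDiffeomorphAt (J.prod K) I ∞ f p)
    (hq : MDifferentiableAt I K q (f p)) (hg : IsLocalDiffeomorphAt K K ∞ g p.2) :
    kerDist I K q (f p) =
      (horizontal J N K Λ p).map (mfderiv (J.prod K) I f p).toLinearMap := by
  have h1 := mfderiv_comp p hq (hf.mdifferentiableAt infty_ne_zero)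
  rw [hqf, mfderiv_comp p (hg.mdifferentiableAt infty_ne_zero) mdifferentiableAt_snd,
    mfderiv_snd] at h1
  have key : ∀ v : TangentSpace (J.prod K) p,
      mfderiv I K q (f p) (mfderiv (J.prod K) I f p v) = mfderiv K K g p.2 v.2 := fun v =>
    (DFunLike.congr_fun h1 v).symm
  ext w
  constructor
  · intro hw
    obtain ⟨v, rfl⟩ := hf.isInvertible_mfderiv.surjective w
    refine ⟨v, ⟨trivial, ?_⟩, rfl⟩
    have h0 : mfderiv K K g p.2 v.2 = 0 := (key v).symm.trans hw
    exact hg.isInvertible_mfderiv.injective (h0.trans (map_zero _).symm)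
  · rintro ⟨v, ⟨-, hv⟩, rfl⟩
    have hv' : v.2 = 0 := hv
    refine (key v).trans ?_
    rw [hv']
    exact map_zero _

theorem map_horizontal_prodMap {a : N₁ → N} {b : Λ₁ → Λ} {p : N₁ × Λ₁}
    (ha : IsLocalDiffeomorphAt J J ∞ a p.1) (hb : IsLocalDiffeomorphAt K K ∞ b p.2) :
    (horizontal J N₁ K Λ₁ p).map (mfderiv (J.prod K) (J.prod K) (Prod.map a b) p).toLinearMap =
      horizontal J N K Λ (Prod.map a b p) := by
  rw [mfderiv_prodMap (ha.mdifferentiableAt infty_ne_zero) (hb.mdifferentiableAt infty_ne_zero)]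
  ext w
  constructor
  · rintro ⟨v, ⟨-, hv⟩, rfl⟩
    have hv' : v.2 = 0 := hv
    refine ⟨trivial, ?_⟩
    show mfderiv K K b p.2 v.2 = 0
    rw [hv']
    exact map_zero _
  · rintro ⟨-, hw⟩
    obtain ⟨v, hv⟩ := ha.isInvertible_mfderiv.surjective w.1
    refine ⟨(v, 0), ⟨trivial, rfl⟩, Prod.ext hv ?_⟩
    exact (map_zero (mfderiv K K b p.2)).trans (Eq.symm hw)

theorem mfderiv_val_restrict (X : VField I M) (U : Opens M) (x : U) :
    mfderiv I I (Subtype.val : U → M) x (X.restrict U x) = X x :=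
  (isInvertible_mfderiv_subtype_val U x).self_apply_inverse _

theorem IsHJESolution.mem_range {X : VField I M} {P : M → N} {σ : N → M} (h : IsHJESolution I J P X σ) (n : N) :
    X (σ n) ∈ LinearMap.range (mfderiv J I σ n).toLinearMap := by
  have aux : ∀ q : TangentBundle J N, q.proj = n →
      tangentMap J I σ q = ⟨σ n, X (σ n)⟩ →
        X (σ n) ∈ LinearMap.range (mfderiv J I σ n).toLinearMap := by
    rintro ⟨_, v⟩ rfl hv
    exact ⟨v, eq_of_heq (Bundle.TotalSpace.mk.inj hv).2⟩
  exact aux _ (h.isSection n) (h.hje n)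

theorem isFibration_fst_comp_symm [Nonempty Λ] (G : Diffeomorph (J.prod K) I (N × Λ) M ∞) :
    IsFibration I J fun x => (G.symm x).1 := by
  refine ⟨contMDiff_fst.comp G.symm.contMDiff, fun n => ?_, fun x => ?_⟩
  · exact ⟨G (n, Classical.arbitrary Λ), by simp⟩
  · have h := mfderiv_comp (I' := J.prod K) (I'' := J) (g := Prod.fst) (f := G.symm) x
      mdifferentiableAt_fst ((G.symm.contMDiff x).mdifferentiableAt infty_ne_zero)
    rw [mfderiv_fst] at h
    show Function.Surjective (mfderiv I J (Prod.fst ∘ G.symm) x)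
    rw [h]
    exact Function.Surjective.comp (g := ContinuousLinearMap.fst ℝ E' E'')
      Prod.fst_surjective (G.symm.isLocalDiffeomorph x).isInvertible_mfderiv.surjective

theorem isFibration_snd_comp_symm [Nonempty N] (G : Diffeomorph (J.prod K) I (N × Λ) M ∞) :
    IsFibration I K fun x => (G.symm x).2 := by
  refine ⟨contMDiff_snd.comp G.symm.contMDiff, fun l => ?_, fun x => ?_⟩
  · exact ⟨G (Classical.arbitrary N, l), by simp⟩
  · have h := mfderiv_comp (I' := J.prod K) (I'' := K) (g := Prod.snd) (f := G.symm) x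
      mdifferentiableAt_snd ((G.symm.contMDiff x).mdifferentiableAt infty_ne_zero)
    rw [mfderiv_snd] at h
    show Function.Surjective (mfderiv I K (Prod.snd ∘ G.symm) x)
    rw [h]
    exact Function.Surjective.comp (g := ContinuousLinearMap.snd ℝ E' E'')
      Prod.snd_surjective (G.symm.isLocalDiffeomorph x).isInvertible_mfderiv.surjective

variable [FiniteDimensional ℝ E'] [FiniteDimensional ℝ E'']

theorem finrank_add_finrank_eq_of_isInvertible {f : N × Λ → M} {p : N × Λ}
    (hf : (mfderiv (J.prod K) I f p).IsInvertible) :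
    Module.finrank ℝ E' + Module.finrank ℝ E'' = Module.finrank ℝ E := by
  obtain ⟨T, -⟩ := hf
  have h : Module.finrank ℝ (E' × E'') = Module.finrank ℝ E := T.toLinearEquiv.finrank_eq
  rwa [Module.finrank_prod] at h

/-! ### Local product structures adapted to a tensor and a vector field -/

variable [FiniteDimensional ℝ E]

variable (I J K) in
/-- A map `f : N × Λ → M` is adapted to `(Ξ, X)` if the images of the slices `N × {l}` are
isotropic and tangent to `X`, and `(f*Ξ)♯((TN × 0)⁰)` is integrable. -/
structure IsAdapted (Ξ : TensorField I M) (X : VField I M) (f : N × Λ → M) : Prop where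
  isotropic : ∀ p, IsIsotropic (Ξ (f p))
    ((horizontal J N K Λ p).map (mfderiv (J.prod K) I f p).toLinearMap)
  field : ∀ p, X (f p) ∈ (horizontal J N K Λ p).map (mfderiv (J.prod K) I f p).toLinearMap
  integrable : IsIntegrable fun p => perp (pullback (J.prod K) f Ξ p) (horizontal J N K Λ p)

variable {Ξ : TensorField I M} {X : VField I M}

theorem IsAdapted.comp_prodMap {f : N × Λ → M} (h : IsAdapted I J K Ξ X f)
    (hf : IsLocalDiffeomorph (J.prod K) I ∞ f) {a : N₁ → N} {b : Λ₁ → Λ}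
    (ha : IsLocalDiffeomorph J J ∞ a) (hb : IsLocalDiffeomorph K K ∞ b) :
    IsAdapted I J K Ξ X (f ∘ Prod.map a b) := by
  have hab : IsLocalDiffeomorph (J.prod K) (J.prod K) ∞ (Prod.map a b) := fun p =>
    (ha p.1).prodMap (hb p.2)
  have hmap : ∀ p, (horizontal J N₁ K Λ₁ p).map
      (mfderiv (J.prod K) I (f ∘ Prod.map a b) p).toLinearMap =
      (horizontal J N K Λ (Prod.map a b p)).map
        (mfderiv (J.prod K) I f (Prod.map a b p)).toLinearMap := fun p => by
    rw [map_mfderiv_comp ((hf _).mdifferentiableAt infty_ne_zero)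
      ((hab p).mdifferentiableAt infty_ne_zero), map_horizontal_prodMap (ha p.1) (hb p.2)]
  refine ⟨fun p => ?_, fun p => ?_, ?_⟩
  · rw [hmap]; exact h.isotropic _
  · rw [hmap]; exact h.field _
  · rw [pullback_comp hf hab]
    refine h.integrable.pull hab fun p => ?_
    rw [map_perp_pullback (hab p).isInvertible_mfderiv, map_horizontal_prodMap (ha p.1) (hb p.2)]

theorem isAdapted_val_comp_iff {U : Opens M} {f : N × Λ → U}
    (hf : IsLocalDiffeomorph (J.prod K) I ∞ f) :
    IsAdapted I J K Ξ X (Subtype.val ∘ f) ↔ IsAdapted I J K (Ξ.restrict U) (X.restrict U) f := by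
  have hv := isLocalDiffeomorph_subtype_val (I := I) U
  have hmap : ∀ p, (horizontal J N K Λ p).map
      (mfderiv (J.prod K) I (Subtype.val ∘ f) p).toLinearMap =
      ((horizontal J N K Λ p).map (mfderiv (J.prod K) I f p).toLinearMap).map
        (mfderiv I I (Subtype.val : U → M) (f p)).toLinearMap := fun p =>
    map_mfderiv_comp ((hv _).mdifferentiableAt infty_ne_zero)
      ((hf p).mdifferentiableAt infty_ne_zero) _
  have h1 : ∀ p, IsIsotropic (Ξ ((Subtype.val ∘ f) p)) ((horizontal J N K Λ p).map
      (mfderiv (J.prod K) I (Subtype.val ∘ f) p).toLinearMap) ↔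
      IsIsotropic (Ξ.restrict U (f p))
        ((horizontal J N K Λ p).map (mfderiv (J.prod K) I f p).toLinearMap) := fun p => by
    rw [hmap]
    exact (isIsotropic_pullback_iff (hv (f p)).isInvertible_mfderiv Ξ _).symm
  have h2 : ∀ p, X ((Subtype.val ∘ f) p) ∈ (horizontal J N K Λ p).map
      (mfderiv (J.prod K) I (Subtype.val ∘ f) p).toLinearMap ↔
      X.restrict U (f p) ∈
        (horizontal J N K Λ p).map (mfderiv (J.prod K) I f p).toLinearMap := fun p => by
    rw [hmap]
    have hinj : Function.Injective (mfderiv I I (Subtype.val : U → M) (f p)).toLinearMap :=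
      (hv (f p)).isInvertible_mfderiv.injective
    have hX : X ((Subtype.val ∘ f) p) =
        (mfderiv I I (Subtype.val : U → M) (f p)).toLinearMap (X.restrict U (f p)) :=
      (mfderiv_val_restrict X U (f p)).symm
    rw [hX]
    exact hinj.mem_set_image
  have h3 : pullback (J.prod K) (Subtype.val ∘ f) Ξ = pullback (J.prod K) f (Ξ.restrict U) :=
    pullback_comp hv hf Ξ
  constructor
  · rintro ⟨a, b, c⟩
    exact ⟨fun p => (h1 p).1 (a p), fun p => (h2 p).1 (b p), h3 ▸ c⟩
  · rintro ⟨a, b, c⟩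
    exact ⟨fun p => (h1 p).2 (a p), fun p => (h2 p).2 (b p), h3 ▸ c⟩

theorem IsCompleteSolution.isAdapted {P : M → N} {S : N × Λ → M}
    (h : IsCompleteSolution I J K P X S) (hiso : IsIsotropicFamily I J Ξ S)
    (hint : IsIntegrable fun p => perp (pullback (J.prod K) S Ξ p) (horizontal J N K Λ p)) :
    IsAdapted I J K Ξ X S := by
  have hd : ∀ p, MDifferentiableAt (J.prod K) I S p := fun p =>
    (h.isLocalDiffeomorph p).mdifferentiableAt infty_ne_zero
  refine ⟨fun ⟨n, l⟩ => ?_, fun ⟨n, l⟩ => ?_, hint⟩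
  · rw [← range_mfderiv_slice (hd (n, l))]
    exact hiso l n
  · rw [← range_mfderiv_slice (hd (n, l))]
    exact (h.partialSolution l).mem_range n

theorem IsAdapted.isIsotropicFamily {S : N × Λ → M} (h : IsAdapted I J K Ξ X S)
    (hS : IsLocalDiffeomorph (J.prod K) I ∞ S) : IsIsotropicFamily I J Ξ S := fun l n => by
  rw [range_mfderiv_slice ((hS (n, l)).mdifferentiableAt infty_ne_zero)]
  exact h.isotropic (n, l)

theorem IsAdapted.isCompleteSolution {S : N × Λ → M} (h : IsAdapted I J K Ξ X S)
    (hS : IsLocalDiffeomorph (J.prod K) I ∞ S) (hsurj : Function.Surjective S) (p : N × Λ)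
    {P : M → N} (hP : ContMDiff I J ∞ P) (hPS : P ∘ S = Prod.fst) :
    IsCompleteSolution I J K P X S where
  dim_eq := finrank_add_finrank_eq_of_isInvertible (hS p).isInvertible_mfderiv
  surjective := hsurj
  isLocalDiffeomorph := hS
  partialSolution l := by
    have hs : ContMDiff J I ∞ fun n => S (n, l) :=
      hS.contMDiff.comp (contMDiff_id.prodMk contMDiff_const)
    refine ⟨hs, fun n => congrFun hPS (n, l), fun n => ?_⟩
    have hX := h.field (n, l)
    rw [← range_mfderiv_slice ((hS (n, l)).mdifferentiableAt infty_ne_zero)] at hX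
    obtain ⟨v, hv⟩ := hX
    have h1 : (⟨S (n, l), X (S (n, l))⟩ : TangentBundle I M) =
        tangentMap J I (fun n => S (n, l)) ⟨n, v⟩ := by
      rw [← hv]; rfl
    have h2 : P ∘ (fun n => S (n, l)) = id := funext fun n => congrFun hPS (n, l)
    rw [h1, ← tangentMap_comp_at _ ((hP _).mdifferentiableAt infty_ne_zero)
      ((hs n).mdifferentiableAt infty_ne_zero), h2, tangentMap_id]
    rfl

theorem IsNCIBy.isAdapted {F : M → Λ₁} (h : IsNCIBy I K Ξ X F) {f : N × Λ → M}
    (hf : IsLocalDiffeomorph (J.prod K) I ∞ f) {g : Λ → Λ₁} (hg : IsLocalDiffeomorph K K ∞ g)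
    (hFf : F ∘ f = g ∘ Prod.snd) : IsAdapted I J K Ξ X f := by
  have hker : ∀ p, kerDist I K F (f p) =
      (horizontal J N K Λ p).map (mfderiv (J.prod K) I f p).toLinearMap := fun p =>
    kerDist_eq_map_horizontal hFf (hf p)
      ((h.fibration.smooth _).mdifferentiableAt infty_ne_zero) (hg p.2)
  refine ⟨fun p => ?_, fun p => ?_, ?_⟩
  · rw [← hker]; exact h.isotropic _
  · rw [← hker]; exact h.firstIntegral _
  · refine h.integrable.pull hf fun p => ?_
    rw [map_perp_pullback (hf p).isInvertible_mfderiv, hker]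

theorem IsAdapted.isNCIBy [Nonempty N] {G : Diffeomorph (J.prod K) I (N × Λ) M ∞}
    (h : IsAdapted I J K Ξ X G) : IsNCIBy I K Ξ X fun x => (G.symm x).2 := by
  have hfib := isFibration_snd_comp_symm G
  have hker : ∀ p, kerDist I K (fun x => (G.symm x).2) (G p) =
      (horizontal J N K Λ p).map (mfderiv (J.prod K) I G p).toLinearMap := fun p =>
    kerDist_eq_map_horizontal (g := id) (funext fun q => by simp) (G.isLocalDiffeomorph p)
      ((hfib.smooth _).mdifferentiableAt infty_ne_zero)
      ((Diffeomorph.refl K Λ ∞).isLocalDiffeomorph p.2)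
  refine ⟨hfib, fun x => ?_, fun x => ?_, ?_⟩
  · obtain ⟨p, rfl⟩ : ∃ p, G p = x := G.surjective x
    rw [hker]; exact h.isotropic p
  · obtain ⟨p, rfl⟩ : ∃ p, G p = x := G.surjective x
    rw [hker]; exact h.field p
  · refine h.integrable.push G.isLocalDiffeomorph G.surjective fun p => ?_
    rw [map_perp_pullback (G.isLocalDiffeomorph p).isInvertible_mfderiv, hker]

end Adapted

/-! ### Product neighborhoods -/

section Box

variable {E : Type*} [NormedAddCommGroup E] [NormedSpace ℝ E]
  {H : Type*} [TopologicalSpace H] {I : ModelWithCorners ℝ E H}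
  {M : Type*} [TopologicalSpace M] [ChartedSpace H M]
  {E' : Type*} [NormedAddCommGroup E'] [NormedSpace ℝ E']
  {H' : Type*} [TopologicalSpace H'] {J : ModelWithCorners ℝ E' H'}
  {N : Type*} [TopologicalSpace N] [ChartedSpace H' N]
  {E'' : Type*} [NormedAddCommGroup E''] [NormedSpace ℝ E'']
  {H'' : Type*} [TopologicalSpace H''] {K : ModelWithCorners ℝ E'' H''}
  {Λ : Type*} [TopologicalSpace Λ] [ChartedSpace H'' Λ]

/-- A partial diffeomorphism onto an open subset of a product restricts, near each point of its
source, to a diffeomorphism onto a product of open subsets. -/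
theorem exists_diffeomorph_prod_opens (e : PartialDiffeomorph I (J.prod K) M (N × Λ) ∞) {m : M}
    (hm : m ∈ e.source) :
    ∃ (U : Opens M) (A : Opens N) (B : Opens Λ) (G : Diffeomorph (J.prod K) I (A × B) U ∞),
      m ∈ U ∧ (∀ x ∈ U, x ∈ e.source) ∧ ∀ p, e (G p) = (↑p.1, ↑p.2) := by
  obtain ⟨a, ha, b, hb, hab⟩ := mem_nhds_prod_iff.1 (e.open_target.mem_nhds (e.map_source hm))
  obtain ⟨a', haa', ha'o, ha'm⟩ := mem_nhds_iff.1 ha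
  obtain ⟨b', hbb', hb'o, hb'm⟩ := mem_nhds_iff.1 hb
  have hab' : a' ×ˢ b' ⊆ e.target := (Set.prod_mono haa' hbb').trans hab
  let A : Opens N := ⟨a', ha'o⟩
  let B : Opens Λ := ⟨b', hb'o⟩
  let U : Opens M := ⟨e.source ∩ e ⁻¹' (a' ×ˢ b'),
    e.contMDiffOn.continuousOn.isOpen_inter_preimage e.open_source (ha'o.prod hb'o)⟩
  have hA : ∀ x : U, (e x).1 ∈ A := fun x => x.2.2.1
  have hB : ∀ x : U, (e x).2 ∈ B := fun x => x.2.2.2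
  have hAB : ∀ p : A × B, ((p.1 : N), (p.2 : Λ)) ∈ e.target := fun p => hab' ⟨p.1.2, p.2.2⟩
  have hU : ∀ p : A × B, e.symm ((p.1 : N), (p.2 : Λ)) ∈ U := fun p =>
    ⟨e.map_target (hAB p), by
      show e (e.symm ((p.1 : N), (p.2 : Λ))) ∈ a' ×ˢ b'
      rw [show e (e.symm ((p.1 : N), (p.2 : Λ))) = _ from e.right_inv (hAB p)]
      exact ⟨p.1.2, p.2.2⟩⟩
  have heU : ContMDiff I (J.prod K) ∞ fun x : U => e x := by
    rw [← contMDiffOn_univ]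
    exact e.contMDiffOn.comp contMDiff_subtype_val.contMDiffOn fun x _ => x.2.1
  have heAB : ContMDiff (J.prod K) I ∞ fun p : A × B => e.symm ((p.1 : N), (p.2 : Λ)) := by
    rw [← contMDiffOn_univ]
    exact e.symm.contMDiffOn.comp
      (contMDiff_subtype_val.prodMap contMDiff_subtype_val).contMDiffOn fun p _ => hAB p
  let G : Diffeomorph (J.prod K) I (A × B) U ∞ :=
    { toFun := fun p => ⟨e.symm ((p.1 : N), (p.2 : Λ)), hU p⟩
      invFun := fun x => (⟨(e x).1, hA x⟩, ⟨(e x).2, hB x⟩)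
      left_inv := fun p => by
        have h : e (e.symm ((p.1 : N), (p.2 : Λ))) = _ := e.right_inv (hAB p)
        exact Prod.ext (Subtype.ext (congrArg Prod.fst h)) (Subtype.ext (congrArg Prod.snd h))
      right_inv := fun x => Subtype.ext (e.left_inv x.2.1)
      contMDiff_toFun := (ContMDiff.subtypeVal_comp_iff U _).1 heAB
      contMDiff_invFun :=
        ((ContMDiff.subtypeVal_comp_iff A _).1 (contMDiff_fst.comp heU)).prodMk
          ((ContMDiff.subtypeVal_comp_iff B _).1 (contMDiff_snd.comp heU)) }
  exact ⟨U, A, B, G, ⟨hm, ha'm, hb'm⟩, fun x hx => hx.1, fun p => e.right_inv (hAB p)⟩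

/-- Two maps which are transverse submersions at a point form a local diffeomorphism there. -/
theorem isLocalDiffeomorphAt_prodMk [CompleteSpace E] [CompleteSpace E'] [CompleteSpace E'']
    [I.Boundaryless] [J.Boundaryless]
    [K.Boundaryless] [IsManifold I ∞ M] [IsManifold J ∞ N] [IsManifold K ∞ Λ]
    {P : M → N} {F : M → Λ} {s : Set M} (hs : IsOpen s) (hP : ContMDiffOn I J ∞ P s)
    (hF : ContMDiffOn I K ∞ F s) {m : M} (hm : m ∈ s)
    (hPm : Function.Surjective (mfderiv I J P m)) (hFm : Function.Surjective (mfderiv I K F m))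
    (hc : IsCompl (LinearMap.ker (mfderiv I J P m).toLinearMap)
      (LinearMap.ker (mfderiv I K F m).toLinearMap)) :
    IsLocalDiffeomorphAt I (J.prod K) ∞ (fun x => (P x, F x)) m := by
  refine isLocalDiffeomorphAt_of_isInvertible_mfderiv hs (hP.prodMk hF) hm ?_
  rw [mfderiv_prodMk ((hP.contMDiffAt (hs.mem_nhds hm)).mdifferentiableAt infty_ne_zero)
    ((hF.contMDiffAt (hs.mem_nhds hm)).mdifferentiableAt infty_ne_zero)]
  exact ⟨ContinuousLinearMap.equivProdOfSurjectiveOfIsCompl (𝕜 := ℝ) (E := E) (F := E') (G := E'')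
    (mfderiv I J P m) (mfderiv I K F m) (LinearMap.range_eq_top.2 hPm)
    (LinearMap.range_eq_top.2 hFm) hc, rfl⟩

/-- Every linear map on a tangent space is the differential of a map defined near the base point. -/
theorem exists_mfderiv_eq [IsManifold I ∞ M] (m : M) (L : E →L[ℝ] E') :
    ∃ P : M → E', ContMDiffOn I 𝓘(ℝ, E') ∞ P (chartAt H m).source ∧
      mfderiv I 𝓘(ℝ, E') P m = L := by
  have : IsManifold I 1 M := .of_le (n := ∞) (by simp)
  obtain ⟨T, hT⟩ := isInvertible_mfderiv_extChartAt (I := I) (mem_extChartAt_source (I := I) m)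
  let L' : E →L[ℝ] E' := L.comp (show E ≃L[ℝ] E from T).symm.toContinuousLinearMap
  have hc : ContMDiffOn I 𝓘(ℝ, E) ∞ (extChartAt I m) (chartAt H m).source :=
    contMDiffOn_extChartAt
  refine ⟨L' ∘ extChartAt I m, L'.contMDiff.comp_contMDiffOn hc, ?_⟩
  rw [mfderiv_comp m L'.mdifferentiableAt ((hc.contMDiffAt ((chartAt H m).open_source.mem_nhds
    (mem_chart_source H m))).mdifferentiableAt infty_ne_zero), ← hT, L'.mfderiv_eq]
  ext v
  exact congrArg L (T.symm_apply_apply v)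

end Box

section Linear

/-- The kernel of a linear map out of a finite-dimensional space is complementary to the kernel of
some surjection onto `ℝᵏ`. -/
theorem exists_surjective_isCompl_ker {V W : Type*} [NormedAddCommGroup V] [NormedSpace ℝ V]
    [FiniteDimensional ℝ V] [AddCommGroup W] [Module ℝ W] (T : V →ₗ[ℝ] W) :
    ∃ (k : ℕ) (L : V →L[ℝ] EuclideanSpace ℝ (Fin k)), Function.Surjective L ∧
      IsCompl (LinearMap.ker L.toLinearMap) (LinearMap.ker T) := by
  obtain ⟨C, hC⟩ := Submodule.exists_isCompl (LinearMap.ker T)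
  let k := Module.finrank ℝ (LinearMap.ker T)
  have hk : Module.finrank ℝ (LinearMap.ker T) =
      Module.finrank ℝ (EuclideanSpace ℝ (Fin k)) := by simp [k]
  let φ : LinearMap.ker T ≃ₗ[ℝ] EuclideanSpace ℝ (Fin k) := LinearEquiv.ofFinrankEq _ _ hk
  let L : V →ₗ[ℝ] EuclideanSpace ℝ (Fin k) :=
    φ.toLinearMap ∘ₗ (LinearMap.ker T).projectionOnto C hC
  refine ⟨k, L.toContinuousLinearMap, ?_, ?_⟩
  · show Function.Surjective L
    exact φ.surjective.comp (Submodule.projectionOnto_surjective hC)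
  · have hker : LinearMap.ker L = C := by
      rw [LinearEquiv.ker_comp, Submodule.ker_projectionOnto]
    show IsCompl (LinearMap.ker L) _
    rw [hker]
    exact hC.symm

end Linear

/-! ### From complete solutions to noncommutative integrability and back -/

section Main

variable {E : Type*} [NormedAddCommGroup E] [NormedSpace ℝ E] [FiniteDimensional ℝ E]
  {H : Type*} [TopologicalSpace H] {I : ModelWithCorners ℝ E H}
  {M : Type*} [TopologicalSpace M] [ChartedSpace H M]
  {E' : Type*} [NormedAddCommGroup E'] [NormedSpace ℝ E'] [FiniteDimensional ℝ E']
  {H' : Type*} [TopologicalSpace H'] {J : ModelWithCorners ℝ E' H'}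
  {N : Type*} [TopologicalSpace N] [ChartedSpace H' N]
  {Ξ : TensorField I M} {X : VField I M}

theorem HasIntegrableIsotropicCompleteSolution.exists_isNCI_restrict {P : M → N}
    (h : HasIntegrableIsotropicCompleteSolution.{w} I J P Ξ X) (m : M) :
    ∃ U : Opens M, m ∈ U ∧ IsNCI.{w} I (Ξ.restrict U) (X.restrict U) := by
  obtain ⟨l, Λ, _, _, _, _, _, S, hS, hiso, hint⟩ := h
  have hSA : IsAdapted I J (𝓡 l) Ξ X S := hS.isAdapted hiso hint
  obtain ⟨p, rfl⟩ := hS.surjective m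
  obtain ⟨Φ, hpΦ, hΦ⟩ := hS.isLocalDiffeomorph p
  have hm : S p ∈ Φ.symm.source := by
    rw [hΦ hpΦ]; exact Φ.map_source hpΦ
  obtain ⟨U, A, B, G, hmU, hU, hG⟩ := exists_diffeomorph_prod_opens Φ.symm hm
  have hSG : S ∘ Prod.map (Subtype.val : A → N) (Subtype.val : B → Λ) = Subtype.val ∘ G := by
    funext q
    have h1 : ((q.1 : N), (q.2 : Λ)) ∈ Φ.source := hG q ▸ Φ.map_target (hU _ (G q).2)
    have h2 : Φ (Φ.symm (G q)) = G q := Φ.right_inv (hU _ (G q).2)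
    rw [hG q] at h2
    exact (hΦ h1).trans h2
  have hA := hSA.comp_prodMap hS.isLocalDiffeomorph
    (isLocalDiffeomorph_subtype_val A) (isLocalDiffeomorph_subtype_val B)
  rw [hSG, isAdapted_val_comp_iff G.isLocalDiffeomorph] at hA
  have : Nonempty A := ⟨(G.symm ⟨S p, hmU⟩).1⟩
  exact ⟨U, hmU, l, B, inferInstance, inferInstance, inferInstance, inferInstance, inferInstance,
    _, hA.isNCIBy⟩

theorem IsNCIBy.exists_completeSolution {l : ℕ} {Λ : Type w} [TopologicalSpace Λ]
    [ChartedSpace (EuclideanSpace ℝ (Fin l)) Λ] [IsManifold (𝓡 l) ∞ Λ] [T2Space Λ]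
    [SecondCountableTopology Λ] {F : M → Λ} (h : IsNCIBy I (𝓡 l) Ξ X F)
    (e : PartialDiffeomorph I (J.prod (𝓡 l)) M (N × Λ) ∞)
    (he : ∀ x ∈ e.source, (e x).2 = F x) {m : M} (hm : m ∈ e.source) :
    ∃ (U : Opens M) (V : Opens N) (π : U → V), m ∈ U ∧ (∀ x ∈ U, x ∈ e.source) ∧
      (∀ x, (π x : N) = (e x).1) ∧ IsFibration I J π ∧
      HasIntegrableIsotropicCompleteSolution.{w} I J π (Ξ.restrict U) (X.restrict U) := by
  obtain ⟨U, A, B, G, hmU, hU, hG⟩ := exists_diffeomorph_prod_opens e hm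
  have hFG : F ∘ Subtype.val ∘ G = Subtype.val ∘ Prod.snd := by
    funext p
    exact (he _ (hU _ (G p).2)).symm.trans (congrArg Prod.snd (hG p))
  have hA : IsAdapted I J (𝓡 l) Ξ X (Subtype.val ∘ G) :=
    h.isAdapted (fun p => (G.isLocalDiffeomorph p).comp I M (isLocalDiffeomorph_subtype_val U (G p)))
      (isLocalDiffeomorph_subtype_val B) hFG
  rw [isAdapted_val_comp_iff G.isLocalDiffeomorph] at hA
  have : Nonempty B := ⟨(G.symm ⟨m, hmU⟩).2⟩
  have hfib := isFibration_fst_comp_symm G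
  refine ⟨U, A, fun x => (G.symm x).1, hmU, hU, fun x => ?_, hfib, l, B, inferInstance,
    inferInstance, inferInstance, inferInstance, inferInstance, G,
    hA.isCompleteSolution G.isLocalDiffeomorph G.surjective (G.symm ⟨m, hmU⟩) hfib.smooth
      (funext fun p => by simp), hA.isIsotropicFamily G.isLocalDiffeomorph, hA.integrable⟩
  have := hG (G.symm x)
  rw [G.apply_symm_apply] at this
  rw [this]

end Main

end HamiltonJacobi

end

open HamiltonJacobi
theorem mainTheorem5 {d k : ℕ}
    {M : Type u} [TopologicalSpace M] [ChartedSpace (EuclideanSpace ℝ (Fin d)) M]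
    [IsManifold (𝓡 d) ∞ M] [T2Space M] [SecondCountableTopology M]
    {N : Type v} [TopologicalSpace N] [ChartedSpace (EuclideanSpace ℝ (Fin k)) N]
    [IsManifold (𝓡 k) ∞ N] [T2Space N] [SecondCountableTopology N]
    (Ξ : TensorField (𝓡 d) M) (hΞ : IsPoisson Ξ)
    (h : M → ℝ) (hh : ContMDiff (𝓡 d) 𝓘(ℝ, ℝ) ∞ h)
    (P : M → N) (hP : IsFibration (𝓡 d) (𝓡 k) P) :
    (HasIntegrableIsotropicCompleteSolution.{w} (𝓡 d) (𝓡 k) P Ξ (hamiltonianField Ξ h) →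
      ∀ m : M, ∃ U : Opens M, m ∈ U ∧
        IsNCI.{w} (𝓡 d) (Ξ.restrict U) ((hamiltonianField Ξ h).restrict U)) ∧
    (∀ (l : ℕ) (Λ : Type w) [TopologicalSpace Λ] [ChartedSpace (EuclideanSpace ℝ (Fin l)) Λ]
        [IsManifold (𝓡 l) ∞ Λ] [T2Space Λ] [SecondCountableTopology Λ] (F : M → Λ),
      IsNCIBy (𝓡 d) (𝓡 l) Ξ (hamiltonianField Ξ h) F →
      Transverse (𝓡 d) (𝓡 k) (𝓡 l) P F →
      ∀ m : M, ∃ (U : Opens M) (V : Opens N) (hUV : ∀ x ∈ U, P x ∈ V),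
        m ∈ U ∧ (V : Set N) = P '' U ∧
        HasIntegrableIsotropicCompleteSolution.{w} (𝓡 d) (𝓡 k) (restrictOpens P U V hUV)
          (Ξ.restrict U) ((hamiltonianField Ξ h).restrict U)) ∧
    (IsNCI.{w} (𝓡 d) Ξ (hamiltonianField Ξ h) →
      ∀ m : M, ∃ (U : Opens M) (k' : ℕ) (N' : Type) (_ : TopologicalSpace N')
        (_ : ChartedSpace (EuclideanSpace ℝ (Fin k')) N') (_ : IsManifold (𝓡 k') ∞ N')
        (_ : T2Space N') (_ : SecondCountableTopology N') (π : U → N'),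
        m ∈ U ∧ IsFibration (𝓡 d) (𝓡 k') π ∧
        HasIntegrableIsotropicCompleteSolution.{w} (𝓡 d) (𝓡 k') π
          (Ξ.restrict U) ((hamiltonianField Ξ h).restrict U)) := by
  refine ⟨fun hsol => hsol.exists_isNCI_restrict, ?_, ?_⟩
  · intro l Λ _ _ _ _ _ F hF hPF m
    obtain ⟨e, hme, he⟩ := isLocalDiffeomorphAt_prodMk isOpen_univ hP.smooth.contMDiffOn
      hF.fibration.smooth.contMDiffOn (Set.mem_univ m) (hP.submersion m)
      (hF.fibration.submersion m) (hPF m)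
    obtain ⟨U, V, π, hmU, hU, hπ, hfib, hsol⟩ := hF.exists_completeSolution e
      (fun x hx => congrArg Prod.snd (he hx).symm) hme
    have hπP : ∀ x : U, (π x : N) = P x := fun x =>
      (hπ x).trans (congrArg Prod.fst (he (hU x x.2)).symm)
    have hUV : ∀ x ∈ U, P x ∈ V := fun x hx => hπP ⟨x, hx⟩ ▸ (π ⟨x, hx⟩).2
    have hres : restrictOpens P U V hUV = π := funext fun x => Subtype.ext (hπP x).symm
    refine ⟨U, V, hUV, hmU, Set.Subset.antisymm ?_ ?_, hres ▸ hsol⟩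
    · intro n hn
      obtain ⟨x, hx⟩ := hfib.surjective ⟨n, hn⟩
      exact ⟨x, x.2, (hπP x).symm.trans (congrArg Subtype.val hx)⟩
    · rintro _ ⟨x, hx, rfl⟩
      exact hUV x hx
  · rintro ⟨l, Λ, _, _, _, _, _, F, hF⟩ m
    obtain ⟨k', L, hL, hLF⟩ := exists_surjective_isCompl_ker (V := EuclideanSpace ℝ (Fin d))
      (mfderiv (𝓡 d) (𝓡 l) F m).toLinearMap
    obtain ⟨Q, hQ, hQm⟩ := exists_mfderiv_eq (I := 𝓡 d) m L
    obtain ⟨e, hme, he⟩ := isLocalDiffeomorphAt_prodMk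
      (chartAt (EuclideanSpace ℝ (Fin d)) m).open_source hQ hF.fibration.smooth.contMDiffOn
      (mem_chart_source _ m) (by rw [hQm]; exact hL) (hF.fibration.submersion m)
      (by rw [hQm]; exact hLF)
    obtain ⟨U, V, π, hmU, -, -, hfib, hsol⟩ := hF.exists_completeSolution e
      (fun x hx => congrArg Prod.snd (he hx).symm) hme
    exact ⟨U, k', V, inferInstance, inferInstance, inferInstance, inferInstance, inferInstance, π,
      hmU, hfib, hsol⟩
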